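/- Let $d\ge 1$ and $\Omega=(0,1)^d$, and let $P_0$ be the uniform distribution on $\Omega$. For $\eta=1/M$ with $M\ge 1$ an integer, partition $\Omega$ (up to a null set) into the $M^d$ cubes $\Delta_j=\eta j+(-\eta,0]^d$, $j\in\{1,\dots,M\}^d$; put $\Delta_j^L=\eta j+(-\eta,-\tfrac{\eta}{2}]^d$, $\Delta_j^R=\eta j+(-\tfrac{\eta}{2},0]^d$, $\phi_{\Delta_j}=\mathbf 1_{\Delta_j^L}-\mathbf 1_{\Delta_j^R}$; let $P_{\Delta_j}$ be the distribution on $\Omega$ with density $1+\tfrac12\phi_{\Delta_j}$, and $\mathcal P_\eta=\{(P_0,P_{\Delta_j}): j\in\{1,\dots,M\}^d\}$. For $B\ge 2$ let $\mathcal P^\infty(d,B)$ be the set of pairs $(P,Q)$ of probability distributions supported on $\Omega$ with Lebesgue densities $p,q$ satisfying $|p-q|\le B$ and $\tfrac1B\le\tfrac{n_1}{n_1+n_2}p+\tfrac{n_2}{n_1+n_2}q\le B$ on $\Omega$. A test is a measurable $\{0,1\}$-valued function $\varphi$ of two independent samples, $X_1,\dots,X_{n_1}$ i.i.d. from $P$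 and $Y_1,\dots,Y_{n_2}$ i.i.d. from $Q$; its expectation is written $\mathbb E_{P,Q}[\varphi]$. It has level $\alpha$ if $\mathbb E_{P,P}[\varphi]\le\alpha$ for every $P$ with $(P,P)\in\mathcal P^\infty(d,B)$. Write $m=\min(n_1,n_2)$. **Corollary 2.** For every $K\ge 1$ there is a constant $c=c(K)>0$ such that for all $\alpha,\beta$ with $0<\beta<1-\alpha$ there is $N=N(K,\alpha,\beta)$ with the following property. For all $d\ge1$ and $B\ge2$, if $m\ge N$ and $\varphi$ is any level-$\alpha$ test, then there is some $\eta\in(0,1)$ with $$\eta\ \ge\ c\Big(\frac{\log m}{m}\Big)^{1/d}$$ such that 1. if $n_2\le K n_1$, there is $(P,Q)\in\mathcal P_\eta$ against which $\varphi$ has power at most $1-\beta$: $\mathbb E_{P,Q}[\varphi]\le 1-\beta$; 2. if $n_1\le K n_2$, there is $(P,Q)\in\mathcal P_\eta$ such that $\varphi$ has power at most $1-\beta$ against the pair with the labels of the two samples exchanged: $\mathbb E_{Q,P}[\varphi]\le 1-\beta$. In particular (take $K=1$), if the two samples are labelled so that $n_2\le n_1$, there is $(P,Q)\in\mathcal P_\eta$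 with $\mathbb E_{P,Q}[\varphi]\le 1-\beta$, with an absolute constant $c$ and $N=N(\alpha,\beta)$. -/

import Mathlib

open MeasureTheory

noncomputable section

namespace TwoSample

/-- The open unit cube `(0,1)^d`. -/
def unitCube (d : ℕ) : Set (Fin d → ℝ) := {x | ∀ i, x i ∈ Set.Ioo (0 : ℝ) 1}

/-- The uniform distribution `P₀` on `(0,1)^d` (the cube has Lebesgue measure `1`). -/
def uniform (d : ℕ) : Measure (Fin d → ℝ) := volume.restrict (unitCube d)

/-- The bottom-left half `η j + (-η, -η/2]^d` of the cube `η j + (-η, 0]^d`. -/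
def lowerHalf {d : ℕ} (η : ℝ) (j : Fin d → ℕ) : Set (Fin d → ℝ) :=
  {x | ∀ i, x i ∈ Set.Ioc (η * j i - η) (η * j i - η / 2)}

/-- The upper-right half `η j + (-η/2, 0]^d` of the cube `η j + (-η, 0]^d`. -/
def upperHalf {d : ℕ} (η : ℝ) (j : Fin d → ℕ) : Set (Fin d → ℝ) :=
  {x | ∀ i, x i ∈ Set.Ioc (η * j i - η / 2) (η * j i)}

/-- The perturbation: `1` on the bottom-left half, `-1` on the upper-right half, `0` elsewhere. -/
def bump {d : ℕ} (η : ℝ) (j : Fin d → ℕ) (x : Fin d → ℝ) : ℝ :=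
  (lowerHalf η j).indicator 1 x - (upperHalf η j).indicator 1 x

/-- The distribution on `(0,1)^d` with density `1 + bump / 2`. -/
def perturbed {d : ℕ} (η : ℝ) (j : Fin d → ℕ) : Measure (Fin d → ℝ) :=
  (uniform d).withDensity fun x => ENNReal.ofReal (1 + 1 / 2 * bump η j x)

/-- The spatially localized alternatives of side length `η = 1/M`: the pairs `(P₀, P_Δ)`, where
`Δ` runs over the `M^d` cubes of side length `η` that partition `(0,1)^d`.
(There is no such partition, and the set is empty, unless `1/η` is a positive integer.) -/
def localized (d : ℕ) (η : ℝ) : Set (Measure (Fin d → ℝ) × Measure (Fin d → ℝ)) :=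
  {PQ | ∃ M : ℕ, (M : ℝ) * η = 1 ∧ ∃ j : Fin d → ℕ, (∀ i, 1 ≤ j i ∧ j i ≤ M) ∧
    PQ = (uniform d, perturbed η j)}

/-- The pairs of probability distributions supported on `(0,1)^d`, with Lebesgue densities `p`, `q`
such that `|p - q| ≤ B` and the mixture `(n₁ p + n₂ q) / (n₁ + n₂)` lies between `1/B` and `B`
on `(0,1)^d`. -/
def regular (d n₁ n₂ : ℕ) (B : ℝ) : Set (Measure (Fin d → ℝ) × Measure (Fin d → ℝ)) :=
  {PQ | IsProbabilityMeasure PQ.1 ∧ IsProbabilityMeasure PQ.2 ∧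
    PQ.1 (unitCube d)ᶜ = 0 ∧ PQ.2 (unitCube d)ᶜ = 0 ∧
    ∃ p q : (Fin d → ℝ) → ℝ, Measurable p ∧ Measurable q ∧ (∀ x, 0 ≤ p x) ∧ (∀ x, 0 ≤ q x) ∧
      PQ.1 = volume.withDensity (fun x => ENNReal.ofReal (p x)) ∧
      PQ.2 = volume.withDensity (fun x => ENNReal.ofReal (q x)) ∧
      ∀ x ∈ unitCube d, |p x - q x| ≤ B ∧
        1 / B ≤ (n₁ : ℝ) / (n₁ + n₂) * p x + (n₂ : ℝ) / (n₁ + n₂) * q x ∧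
        (n₁ : ℝ) / (n₁ + n₂) * p x + (n₂ : ℝ) / (n₁ + n₂) * q x ≤ B}

/-- The data: a sample of size `n₁` and a sample of size `n₂`, both in `ℝ^d`. -/
abbrev Data (d n₁ n₂ : ℕ) : Type := (Fin n₁ → Fin d → ℝ) × (Fin n₂ → Fin d → ℝ)

/-- A test is a measurable `{0,1}`-valued function of the two samples. -/
def IsTest {d n₁ n₂ : ℕ} (φ : Data d n₁ n₂ → ℝ) : Prop :=
  Measurable φ ∧ ∀ z, φ z = 0 ∨ φ z = 1

/-- `E_{P,Q}[φ]`: the two samples are independent, the first i.i.d. from `P`, the second i.i.d.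
from `Q`. -/
def expectation {d n₁ n₂ : ℕ} (P Q : Measure (Fin d → ℝ)) (φ : Data d n₁ n₂ → ℝ) : ℝ :=
  ∫ z, φ z ∂((Measure.pi fun _ : Fin n₁ => P).prod (Measure.pi fun _ : Fin n₂ => Q))

/-- `φ` has level `α` for the null hypothesis `P = Q` (under the regularity conditions). -/
def HasLevel {d n₁ n₂ : ℕ} (B α : ℝ) (φ : Data d n₁ n₂ → ℝ) : Prop :=
  ∀ P : Measure (Fin d → ℝ), (P, P) ∈ regular d n₁ n₂ B → expectation P P φ ≤ α

end TwoSample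

end

/-! This is a second moment argument against a uniform mixture of the `M ^ d` localized
alternatives. Only one sample, of size `n`, is perturbed, so the likelihood ratio `L j` against the
uniform null is a product over that sample. Bumps on different cubes have mean zero and disjoint
supports, hence `E[L j * L k] = 1` for `j ≠ k`, while `E[L j ^ 2] ≤ (1 + ρ) ^ n` with `ρ = (η / 2) ^
d / 2`. The average of the `L j` therefore has variance at most `(1 + ρ) ^ n * η ^ d`. Once this is
at most `δ ^ 2`, the average power exceeds the level by at most `δ`, and some alternative does no
better than the average (`exists_integral_pi_withDensity_le`).

With `M ^ d ≥ K * m / log m` and `n ≤ K * m`, one has `(1 + ρ) ^ n ≤ √m`, so the variance is at most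
`log m / √m`, which is below `δ ^ 2` for large `m` (`exists_scale`, `second_moment_le`). The choice
`δ = 1 - α - β` gives power at most `1 - β`. -/

/-! ### Second moment method for product measures. -/

theorem pi_withDensity_ofReal {ι E : Type*} [Fintype ι] [MeasurableSpace E] (μ : Measure E)
    [IsFiniteMeasure μ] {g : E → ℝ} (hg : Integrable g μ) (h0 : ∀ x, 0 ≤ g x) :
    Measure.pi (fun _ : ι => μ.withDensity fun x => ENNReal.ofReal (g x)) =
      (Measure.pi fun _ : ι => μ).withDensity fun x => ENNReal.ofReal (∏ i, g (x i)) := by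
  have : IsFiniteMeasure (μ.withDensity fun x => ENNReal.ofReal (g x)) :=
    isFiniteMeasure_withDensity_ofReal hg.2
  refine Measure.pi_eq fun s hs => ?_
  rw [withDensity_apply _ (MeasurableSet.univ_pi hs), Measure.restrict_pi_pi,
    ← ofReal_integral_eq_lintegral_ofReal, integral_fintype_prod_eq_prod (fun _ => g),
    ENNReal.ofReal_prod_of_nonneg]
  · refine Finset.prod_congr rfl fun i _ => ?_
    rw [withDensity_apply _ (hs i), ofReal_integral_eq_lintegral_ofReal hg.integrableOn
      (Filter.Eventually.of_forall h0)]
  · exact fun i _ => integral_nonneg h0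
  · exact Integrable.fintype_prod fun i => hg.integrableOn
  · exact Filter.Eventually.of_forall fun x => Finset.prod_nonneg fun i _ => h0 _

/-- **Second moment method.** If the densities `g j` are nearly orthogonal perturbations of `1`,
then for some `j` a test can hardly tell `g j • μ` from `μ` on the basis of a sample. -/
theorem exists_integral_pi_withDensity_le {ι E X κ : Type*} [Fintype ι] [Fintype κ] [Nonempty ι]
    [MeasurableSpace E] [MeasurableSpace X] (μ : Measure E) [IsProbabilityMeasure μ]
    (ν : Measure X) [IsProbabilityMeasure ν] {g : ι → E → ℝ} {C ρ δ : ℝ}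
    (hg : ∀ j, Measurable (g j)) (h0 : ∀ j x, 0 ≤ g j x) (hC : ∀ j x, g j x ≤ C)
    (h1 : ∀ j, ∫ x, g j x ∂μ = 1) (hne : ∀ j k, j ≠ k → ∫ x, g j x * g k x ∂μ = 1)
    (hρ : ∀ j, ∫ x, g j x * g j x ∂μ ≤ 1 + ρ) (hδ : 0 < δ)
    (hcard : (1 + ρ) ^ Fintype.card κ / Fintype.card ι ≤ δ ^ 2)
    {φ : X × (κ → E) → ℝ} (hφ : Measurable φ) (hφ0 : ∀ z, 0 ≤ φ z) (hφ1 : ∀ z, φ z ≤ 1) :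
    ∃ j, ∫ z, φ z ∂(ν.prod (Measure.pi fun _ : κ =>
        μ.withDensity fun x => ENNReal.ofReal (g j x))) ≤
      ∫ z, φ z ∂(ν.prod (Measure.pi fun _ : κ => μ)) + δ := by
  classical
  set π := ν.prod (Measure.pi fun _ : κ => μ) with hπ
  set L : ι → (κ → E) → ℝ := fun j y => ∏ i, g j (y i) with hL
  have hint (j) : Integrable (g j) μ :=
    Integrable.of_bound (hg j).aestronglyMeasurable C
      (.of_forall fun x => by rw [Real.norm_of_nonneg (h0 j x)]; exact hC j x)
  have hint2 (j k) : Integrable (fun x => g j x * g k x) μ :=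
    Integrable.of_bound ((hg j).mul (hg k)).aestronglyMeasurable (C * C)
      (.of_forall fun x => by
        rw [Real.norm_of_nonneg (mul_nonneg (h0 j x) (h0 k x))]
        exact mul_le_mul (hC j x) (hC k x) (h0 k x) ((h0 j x).trans (hC j x)))
  have hLm (j) : Measurable fun z : X × (κ → E) => L j z.2 := by
    simp only [hL]; fun_prop
  have hLi (j) : Integrable (fun z : X × (κ → E) => L j z.2) π :=
    (Integrable.fintype_prod (μ := fun _ : κ => μ) fun _ => hint j).comp_snd ν
  have hLL (j k) (y) : L j y * L k y = ∏ i, g j (y i) * g k (y i) := by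
    simp only [hL, Finset.prod_mul_distrib]
  have hLLi (j k) : Integrable (fun z : X × (κ → E) => L j z.2 * L k z.2) π := by
    simp only [hLL]
    exact (Integrable.fintype_prod (μ := fun _ : κ => μ) fun _ => hint2 j k).comp_snd ν
  have hL1 (j) : ∫ z, L j z.2 ∂π = 1 := by
    rw [hπ, integral_fun_snd (L j), integral_fintype_prod_eq_pow, h1]; simp
  have hLLe (j k) : ∫ z, L j z.2 * L k z.2 ∂π = (∫ x, g j x * g k x ∂μ) ^ Fintype.card κ := by
    simp only [hLL]
    rw [hπ, integral_fun_snd fun y : κ → E => ∏ i, g j (y i) * g k (y i),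
      integral_fintype_prod_eq_pow fun x => g j x * g k x]; simp
  have hLφi (j) : Integrable (fun z => L j z.2 * φ z) π :=
    (hLi j).mono' ((hLm j).mul hφ).aestronglyMeasurable (.of_forall fun z => by
      have : 0 ≤ L j z.2 := Finset.prod_nonneg fun i _ => h0 _ _
      rw [Real.norm_of_nonneg (mul_nonneg this (hφ0 z))]
      exact mul_le_of_le_one_right this (hφ1 z))
  have hφi : Integrable φ π := Integrable.of_bound hφ.aestronglyMeasurable 1
    (.of_forall fun z => by rw [Real.norm_of_nonneg (hφ0 z)]; exact hφ1 z)
  -- Change of measure: the factor `ν` is unperturbed, so the likelihood ratio depends on `z.2`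
  -- only.
  have hE (j) : ∫ z, φ z ∂(ν.prod (Measure.pi fun _ : κ =>
      μ.withDensity fun x => ENNReal.ofReal (g j x))) = ∫ z, L j z.2 * φ z ∂π := by
    rw [pi_withDensity_ofReal μ (hint j) (h0 j), prod_withDensity_right (by fun_prop),
      integral_withDensity_eq_integral_toReal_smul (by fun_prop) (by simp)]
    refine integral_congr_ae (.of_forall fun z => ?_)
    simp only [smul_eq_mul]
    rw [ENNReal.toReal_ofReal (Finset.prod_nonneg fun i _ => h0 _ _)]
  simp only [hE]
  by_contra! hcon
  set N : ℝ := ((Fintype.card ι : ℕ) : ℝ) with hN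
  have hNpos : 0 < N := by simp only [hN]; exact_mod_cast Fintype.card_pos
  have hsum : N * (∫ z, φ z ∂π + δ) < ∑ j, ∫ z, L j z.2 * φ z ∂π := by
    have := Finset.sum_lt_sum_of_nonempty (Finset.univ_nonempty (α := ι)) fun j _ => hcon j
    simpa only [Finset.sum_const, Finset.card_univ, nsmul_eq_mul] using this
  -- With `S = ∑ j, L j`, this is `(S - N) * φ ≤ N * δ / 2 + (S - N) ^ 2 / (2 * N * δ)`, from
  -- completing the square and `φ ^ 2 ≤ 1`. Integrated, it replaces Cauchy–Schwarz.
  have hpt : ∀ z, (∑ j, L j z.2 * φ z) - N * φ z ≤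
      N * δ / 2 + ((∑ j, ∑ k, L j z.2 * L k z.2) - 2 * N * (∑ j, L j z.2) + N ^ 2) /
        (2 * N * δ) := by
    intro z
    rw [← Finset.sum_mul, ← Finset.sum_mul_sum]
    set S := ∑ j, L j z.2
    have e : N * δ / 2 + (S * S - 2 * N * S + N ^ 2) / (2 * N * δ) - (S * φ z - N * φ z)
        = ((N * δ * φ z - (S - N)) ^ 2 + (N * δ) ^ 2 * (1 - φ z ^ 2)) / (2 * N * δ) := by
      field_simp; ring
    have : φ z ^ 2 ≤ 1 := pow_le_one₀ (hφ0 z) (hφ1 z)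
    rw [← sub_nonneg, e]
    have : 0 ≤ 1 - φ z ^ 2 := by linarith
    positivity
  have i1 : Integrable (fun z => ∑ j, L j z.2 * φ z) π :=
    integrable_finsetSum _ fun j _ => hLφi j
  have i2 : Integrable (fun z => ∑ j, ∑ k, L j z.2 * L k z.2) π :=
    integrable_finsetSum _ fun j _ => integrable_finsetSum _ fun k _ => hLLi j k
  have i3 : Integrable (fun z => ∑ j, L j z.2) π := integrable_finsetSum _ fun j _ => hLi j
  have i4 : Integrable (fun z => (∑ j, ∑ k, L j z.2 * L k z.2) - 2 * N * ∑ j, L j z.2) π :=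
    i2.sub (i3.const_mul _)
  have i5 : Integrable (fun z => ((∑ j, ∑ k, L j z.2 * L k z.2) - 2 * N * (∑ j, L j z.2) +
      N ^ 2) / (2 * N * δ)) π := (i4.add (integrable_const _)).div_const _
  have hI := integral_mono (i1.sub (hφi.const_mul N)) ((integrable_const (N * δ / 2)).add i5) hpt
  simp only [Pi.add_apply, Pi.sub_apply] at hI
  rw [integral_sub i1 (hφi.const_mul N), integral_add (integrable_const _) i5,
    integral_div (2 * N * δ), integral_add i4 (integrable_const _),
    integral_sub i2 (i3.const_mul (2 * N)), integral_const_mul, integral_const_mul,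
    integral_finsetSum _ fun j _ => hLφi j, integral_finsetSum _ fun j _ => hLi j,
    integral_finsetSum _ fun j _ => integrable_finsetSum _ fun k _ => hLLi j k] at hI
  simp_rw [integral_finsetSum Finset.univ fun k _ => hLLi _ k, hL1, hLLe] at hI
  -- A superfluous `1` is kept on the diagonal, so that the ones add up to `N ^ 2` and cancel in the
  -- variance.
  have hdouble : ∑ j, ∑ k, (∫ x, g j x * g k x ∂μ) ^ Fintype.card κ ≤
      N ^ 2 + N * (1 + ρ) ^ Fintype.card κ := by
    calc _ ≤ ∑ j : ι, ∑ k : ι, (1 + if j = k then (1 + ρ) ^ Fintype.card κ else 0) := by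
          refine Finset.sum_le_sum fun j _ => Finset.sum_le_sum fun k _ => ?_
          split_ifs with h
          · subst h
            refine (pow_le_pow_left₀ (integral_nonneg fun x => mul_self_nonneg _) (hρ j) _).trans ?_
            linarith
          · rw [hne j k h]; simp
      _ = _ := by simp [Finset.sum_add_distrib, hN]; ring
  have h3 : (1 + ρ) ^ Fintype.card κ ≤ N * δ ^ 2 := by
    rw [div_le_iff₀ hNpos] at hcard; linarith
  have h4 : ((∑ j, ∑ k, (∫ x, g j x * g k x ∂μ) ^ Fintype.card κ) -
      2 * N * (∑ _j : ι, (1 : ℝ)) + N ^ 2) / (2 * N * δ) ≤ N * δ / 2 := by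
    rw [div_le_iff₀ (by positivity)]
    have : ∑ _j : ι, (1 : ℝ) = N := by simp [hN]
    rw [this]
    have := mul_le_mul_of_nonneg_left h3 hNpos.le
    nlinarith
  simp only [integral_const, probReal_univ, one_smul] at hI
  linarith
-- The uniform distribution and the bumps.
namespace TwoSample

/-- `Ioc` instead of `Ioo` lets the half-open boxes touching the face `x i = 1` lie inside the
support. -/
theorem uniform_eq_pi (d : ℕ) :
    uniform d = Measure.pi fun _ : Fin d => (volume : Measure ℝ).restrict (Set.Ioc 0 1) := by
  have : unitCube d = Set.univ.pi fun _ => Set.Ioo (0 : ℝ) 1 := by ext; simp [unitCube]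
  rw [uniform, this, volume_pi, Measure.restrict_pi_pi]
  congr 1; funext i; exact Measure.restrict_congr_set Ioo_ae_eq_Ioc

instance (d : ℕ) : IsProbabilityMeasure (uniform d) := by
  have : IsProbabilityMeasure ((volume : Measure ℝ).restrict (Set.Ioc 0 1)) := ⟨by simp⟩
  rw [uniform_eq_pi]; infer_instance

theorem measurableSet_unitCube (d : ℕ) : MeasurableSet (unitCube d) := by
  have : unitCube d = Set.univ.pi fun _ => Set.Ioo (0 : ℝ) 1 := by ext; simp [unitCube]
  rw [this]; exact MeasurableSet.univ_pi fun _ => measurableSet_Ioo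

variable {d : ℕ} {η : ℝ} {j k : Fin d → ℕ}

theorem lowerHalf_eq_pi : lowerHalf η j =
    Set.univ.pi fun i => Set.Ioc (η * j i - η) (η * j i - η / 2) := by
  ext; simp [lowerHalf]

theorem upperHalf_eq_pi : upperHalf η j =
    Set.univ.pi fun i => Set.Ioc (η * j i - η / 2) (η * j i) := by
  ext; simp [upperHalf]

theorem measurableSet_lowerHalf : MeasurableSet (lowerHalf η j) := by
  rw [lowerHalf_eq_pi]; exact MeasurableSet.univ_pi fun _ => measurableSet_Ioc

theorem measurableSet_upperHalf : MeasurableSet (upperHalf η j) := by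
  rw [upperHalf_eq_pi]; exact MeasurableSet.univ_pi fun _ => measurableSet_Ioc

theorem uniform_real_pi_Ioc {a b : Fin d → ℝ} (h0 : ∀ i, 0 ≤ a i) (hab : ∀ i, a i ≤ b i)
    (h1 : ∀ i, b i ≤ 1) :
    (uniform d).real (Set.univ.pi fun i => Set.Ioc (a i) (b i)) = ∏ i, (b i - a i) := by
  rw [measureReal_def, uniform_eq_pi, Measure.pi_pi, ENNReal.toReal_prod]
  refine Finset.prod_congr rfl fun i _ => ?_
  rw [Measure.restrict_apply measurableSet_Ioc, Set.inter_eq_left.2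
    (Set.Ioc_subset_Ioc (h0 i) (h1 i)), Real.volume_Ioc, ENNReal.toReal_ofReal (by linarith [hab i])]

theorem uniform_real_halves {M : ℕ} (hM : (M : ℝ) * η = 1) (hj : ∀ i, 1 ≤ j i ∧ j i ≤ M) :
    (uniform d).real (lowerHalf η j) = (η / 2) ^ d ∧
      (uniform d).real (upperHalf η j) = (η / 2) ^ d := by
  have hη : 0 ≤ η := by
    by_contra! h
    nlinarith [Nat.cast_nonneg (α := ℝ) M]
  have hl (i) : 0 ≤ η * j i - η := by
    have : (1 : ℝ) ≤ j i := by exact_mod_cast (hj i).1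
    nlinarith
  have hu (i) : η * j i ≤ 1 := by
    have : (j i : ℝ) ≤ M := by exact_mod_cast (hj i).2
    nlinarith
  rw [lowerHalf_eq_pi, upperHalf_eq_pi,
    uniform_real_pi_Ioc hl (fun i => by linarith) (fun i => by linarith [hu i]),
    uniform_real_pi_Ioc (fun i => by linarith [hl i]) (fun i => by linarith) hu]
  have e (t : ℝ) : t - η / 2 - (t - η) = η / 2 := by ring
  simp only [sub_sub_cancel, e, Finset.prod_const, Finset.card_univ, Fintype.card_fin, and_self]

theorem measurable_bump : Measurable (bump η j) :=
  (measurable_one.indicator measurableSet_lowerHalf).sub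
    (measurable_one.indicator measurableSet_upperHalf)

theorem abs_bump_le (x : Fin d → ℝ) : |bump η j x| ≤ 1 := by
  unfold bump Set.indicator
  split_ifs <;> simp

theorem integrable_indicator_one {s : Set (Fin d → ℝ)} (hs : MeasurableSet s) :
    Integrable (s.indicator (1 : (Fin d → ℝ) → ℝ)) (uniform d) :=
  (integrable_const (1 : ℝ)).indicator hs

theorem integral_bump {M : ℕ} (hM : (M : ℝ) * η = 1) (hj : ∀ i, 1 ≤ j i ∧ j i ≤ M) :
    ∫ x, bump η j x ∂uniform d = 0 := by
  unfold bump
  rw [integral_sub (integrable_indicator_one measurableSet_lowerHalf)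
    (integrable_indicator_one measurableSet_upperHalf),
    integral_indicator_one measurableSet_lowerHalf, integral_indicator_one measurableSet_upperHalf,
    (uniform_real_halves hM hj).1, (uniform_real_halves hM hj).2, sub_self]

/-- Bounding the square by the sum of the two indicators avoids proving the halves disjoint. -/
theorem integral_bump_mul_self_le {M : ℕ} (hM : (M : ℝ) * η = 1)
    (hj : ∀ i, 1 ≤ j i ∧ j i ≤ M) :
    ∫ x, bump η j x * bump η j x ∂uniform d ≤ 2 * (η / 2) ^ d := by
  have h := uniform_real_halves hM hj
  calc _ ≤ ∫ x, ((lowerHalf η j).indicator (1 : (Fin d → ℝ) → ℝ) x +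
        (upperHalf η j).indicator (1 : (Fin d → ℝ) → ℝ) x) ∂uniform d := by
        refine integral_mono_of_nonneg (.of_forall fun x => mul_self_nonneg _)
          ((integrable_indicator_one measurableSet_lowerHalf).add
            (integrable_indicator_one measurableSet_upperHalf)) (.of_forall fun x => ?_)
        simp only [bump, Set.indicator]
        split_ifs <;> simp
    _ = _ := by
      rw [integral_add (integrable_indicator_one measurableSet_lowerHalf)
        (integrable_indicator_one measurableSet_upperHalf),
        integral_indicator_one measurableSet_lowerHalf,
        integral_indicator_one measurableSet_upperHalf, h.1, h.2]
      ring

theorem mem_Ioc_of_bump_ne_zero (hη : 0 ≤ η) {x : Fin d → ℝ} (hx : bump η j x ≠ 0) (i : Fin d) :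
    x i ∈ Set.Ioc (η * j i - η) (η * j i) := by
  by_cases hl : x ∈ lowerHalf η j
  · exact ⟨(hl i).1, (hl i).2.trans (by linarith)⟩
  by_cases hu : x ∈ upperHalf η j
  · exact ⟨by linarith [(hu i).1], (hu i).2⟩
  · simp [bump, hl, hu] at hx

theorem bump_mul_bump (hη : 0 < η) (hjk : j ≠ k) (x : Fin d → ℝ) :
    bump η j x * bump η k x = 0 := by
  by_contra h
  obtain ⟨i, hi⟩ := Function.ne_iff.1 hjk
  have h1 := mem_Ioc_of_bump_ne_zero hη.le (left_ne_zero_of_mul h) i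
  have h2 := mem_Ioc_of_bump_ne_zero hη.le (right_ne_zero_of_mul h) i
  rcases hi.lt_or_gt with hlt | hlt
  · have : (j i : ℝ) + 1 ≤ k i := by exact_mod_cast hlt
    nlinarith [h1.2, h2.1]
  · have : (k i : ℝ) + 1 ≤ j i := by exact_mod_cast hlt
    nlinarith [h2.2, h1.1]

theorem integrable_bump : Integrable (bump η j) (uniform d) :=
  Integrable.of_bound measurable_bump.aestronglyMeasurable 1 (.of_forall abs_bump_le)

theorem integrable_bump_mul_bump :
    Integrable (fun x => bump η j x * bump η k x) (uniform d) :=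
  Integrable.of_bound (measurable_bump.mul measurable_bump).aestronglyMeasurable 1
    (.of_forall fun x => by
      rw [norm_mul]; exact mul_le_one₀ (abs_bump_le x) (norm_nonneg _) (abs_bump_le x))

/-- The linear terms vanish because the bumps have mean zero. -/
theorem integral_density_mul_density {M : ℕ} (hM : (M : ℝ) * η = 1)
    (hj : ∀ i, 1 ≤ j i ∧ j i ≤ M) (hk : ∀ i, 1 ≤ k i ∧ k i ≤ M) :
    ∫ x, (1 + 1 / 2 * bump η j x) * (1 + 1 / 2 * bump η k x) ∂uniform d =
      1 + 1 / 4 * ∫ x, bump η j x * bump η k x ∂uniform d := by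
  have e (x : Fin d → ℝ) : (1 + 1 / 2 * bump η j x) * (1 + 1 / 2 * bump η k x) =
      1 + 1 / 2 * bump η j x + 1 / 2 * bump η k x + 1 / 4 * (bump η j x * bump η k x) := by ring
  simp only [e]
  have i1 : Integrable (fun x => 1 + 1 / 2 * bump η j x) (uniform d) :=
    (integrable_const _).add (integrable_bump.const_mul _)
  have i2 : Integrable (fun x => 1 / 2 * bump η k x) (uniform d) := integrable_bump.const_mul _
  have i3 : Integrable (fun x => 1 + 1 / 2 * bump η j x + 1 / 2 * bump η k x) (uniform d) :=
    i1.add i2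
  rw [integral_add i3 (integrable_bump_mul_bump.const_mul _), integral_add i1 i2,
    integral_add (integrable_const _) (integrable_bump.const_mul _)]
  simp only [integral_const_mul, integral_bump hM hj, integral_bump hM hk, integral_const,
    probReal_univ, one_smul, mul_zero, add_zero]

theorem integral_density {M : ℕ} (hM : (M : ℝ) * η = 1) (hj : ∀ i, 1 ≤ j i ∧ j i ≤ M) :
    ∫ x, (1 + 1 / 2 * bump η j x) ∂uniform d = 1 := by
  rw [integral_add (integrable_const _) (integrable_bump.const_mul _), integral_const_mul,
    integral_bump hM hj]
  simp

/-- Allows the level condition to be applied at the uniform null, the only null used. -/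
theorem uniform_mem_regular {n₁ n₂ : ℕ} (hn : 0 < n₁ + n₂) {B : ℝ} (hB : 1 ≤ B) :
    (uniform d, uniform d) ∈ regular d n₁ n₂ B := by
  have hc : uniform d (unitCube d)ᶜ = 0 := by
    rw [uniform, Measure.restrict_apply (measurableSet_unitCube d).compl]; simp
  have hm : Measurable ((unitCube d).indicator (1 : (Fin d → ℝ) → ℝ)) :=
    measurable_one.indicator (measurableSet_unitCube d)
  have h0 (x) : 0 ≤ (unitCube d).indicator (1 : (Fin d → ℝ) → ℝ) x :=
    Set.indicator_nonneg (fun _ _ => zero_le_one) x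
  have hd : uniform d = volume.withDensity fun x =>
      ENNReal.ofReal ((unitCube d).indicator (1 : (Fin d → ℝ) → ℝ) x) := by
    rw [uniform, ← withDensity_indicator_one (measurableSet_unitCube d)]
    congr 1; funext x
    by_cases hx : x ∈ unitCube d <;> simp [hx]
  refine ⟨inferInstance, inferInstance, hc, hc, _, _, hm, hm, h0, h0, hd, hd, fun x hx => ?_⟩
  have : (0 : ℝ) < n₁ + n₂ := by exact_mod_cast hn
  simp only [hx, Set.indicator_of_mem, Pi.one_apply, mul_one, ← add_div, div_self this.ne',
    sub_self, abs_zero]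
  exact ⟨by linarith, (div_le_one (by linarith)).2 hB, hB⟩

/-! ### Choice of the scale and the resulting second moment. -/

/-- A test based on a sample from the uniform distribution misses some localized alternative. -/
theorem exists_integral_perturbed_le {d n M : ℕ} {η δ : ℝ} (hM : (M : ℝ) * η = 1) (hδ : 0 < δ)
    (h : (1 + 1 / 2 * (η / 2) ^ d) ^ n * η ^ d ≤ δ ^ 2) {X : Type*} [MeasurableSpace X]
    (ν : Measure X) [IsProbabilityMeasure ν] {φ : X × (Fin n → Fin d → ℝ) → ℝ}
    (hφ : Measurable φ) (hφ0 : ∀ z, 0 ≤ φ z) (hφ1 : ∀ z, φ z ≤ 1) :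
    ∃ j : Fin d → ℕ, (∀ i, 1 ≤ j i ∧ j i ≤ M) ∧
      ∫ z, φ z ∂(ν.prod (Measure.pi fun _ : Fin n => perturbed η j)) ≤
        ∫ z, φ z ∂(ν.prod (Measure.pi fun _ : Fin n => uniform d)) + δ := by
  have hM0 : (M : ℝ) ≠ 0 := left_ne_zero_of_mul (hM.trans_ne one_ne_zero)
  have : NeZero M := ⟨by exact_mod_cast hM0⟩
  have hη : η = (M : ℝ)⁻¹ := eq_inv_of_mul_eq_one_right hM
  have hηpos : 0 < η := hη ▸ inv_pos.2 (lt_of_le_of_ne (Nat.cast_nonneg M) hM0.symm)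
  -- The cubes are numbered from `1`, while `Fin M` starts at `0`.
  set J : (Fin d → Fin M) → Fin d → ℕ := fun j i => j i + 1 with hJ
  have hJr (j) (i) : 1 ≤ J j i ∧ J j i ≤ M := ⟨Nat.le_add_left _ _, (j i).isLt⟩
  have hJi : Function.Injective J := fun j k hjk => by
    funext i
    have := congrFun hjk i
    simp only [hJ, add_left_inj] at this
    exact Fin.ext this
  obtain ⟨j, hj⟩ := exists_integral_pi_withDensity_le (κ := Fin n) (uniform d) ν
    (g := fun j x => 1 + 1 / 2 * bump η (J j) x) (C := 2) (ρ := 1 / 2 * (η / 2) ^ d) (δ := δ)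
    (fun j => (measurable_bump.const_mul _).const_add _)
    (fun j x => by linarith [(abs_le.1 (abs_bump_le (η := η) (j := J j) x)).1])
    (fun j x => by linarith [(abs_le.1 (abs_bump_le (η := η) (j := J j) x)).2])
    (fun j => integral_density hM (hJr j))
    (fun j k hjk => by
      rw [integral_density_mul_density hM (hJr j) (hJr k)]
      simp [bump_mul_bump hηpos (hJi.ne hjk)])
    (fun j => by
      rw [integral_density_mul_density hM (hJr j) (hJr j)]
      linarith [integral_bump_mul_self_le hM (hJr j)])
    hδ
    -- The number of alternatives is `M ^ d`, and dividing by it is multiplying by `η ^ d`.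
    (by
      rw [hη] at h ⊢
      simpa [div_eq_mul_inv] using h)
    hφ hφ0 hφ1
  exact ⟨J j, hJr j, hj⟩

theorem exists_scale {K m : ℝ} (hK : 1 ≤ K) (hm : 1 < m) {d : ℕ} (hd : 1 ≤ d) :
    ∃ M : ℕ, 2 ≤ M ∧ K * m / Real.log m ≤ (M : ℝ) ^ d ∧
      1 / (3 * K) * (Real.log m / m) ^ (1 / (d : ℝ)) ≤ (M : ℝ)⁻¹ := by
  have hlog := Real.log_pos hm
  have hd0 : d ≠ 0 := by omega
  have hd1 : 1 / (d : ℝ) ≤ 1 := (div_le_one (by positivity)).2 (by exact_mod_cast hd)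
  set t := (m / Real.log m) ^ (1 / (d : ℝ)) with ht
  have ht1 : 1 ≤ t := Real.one_le_rpow
    ((one_le_div hlog).2 ((Real.log_le_sub_one_of_pos (by linarith)).trans (by linarith)))
    (by positivity)
  set x := K ^ (1 / (d : ℝ)) * t with hx
  have hKr : 1 ≤ K ^ (1 / (d : ℝ)) := Real.one_le_rpow hK (by positivity)
  -- This makes the final constant independent of `d`.
  have hKK : K ^ (1 / (d : ℝ)) ≤ K := by
    simpa using Real.rpow_le_rpow_of_exponent_le hK hd1
  have hx1 : 1 ≤ x := one_le_mul_of_one_le_of_one_le hKr ht1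
  have hxd : x ^ d = K * m / Real.log m := by
    rw [hx, ht, mul_pow, one_div, Real.rpow_inv_natCast_pow (by linarith) hd0,
      Real.rpow_inv_natCast_pow (by positivity) hd0, mul_div_assoc]
  -- The extra `1` forces `M ≥ 2`, hence `η < 1`. Since `x ≥ 1`, still `M ≤ x + 2 ≤ 3 * x`, whence
  -- the `3` in the constant.
  refine ⟨⌈x⌉₊ + 1, ?_, ?_, ?_⟩
  · have := Nat.ceil_pos.2 (zero_lt_one.trans_le hx1)
    omega
  · rw [← hxd]
    refine pow_le_pow_left₀ (by linarith) ?_ d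
    push_cast
    linarith [Nat.le_ceil x]
  · have hM : ((⌈x⌉₊ + 1 : ℕ) : ℝ) ≤ 3 * K * t := by
      push_cast
      have := Nat.ceil_lt_add_one (zero_le_one.trans hx1)
      have : x ≤ K * t := mul_le_mul_of_nonneg_right hKK (by linarith)
      linarith
    have e : 1 / (3 * K) * (Real.log m / m) ^ (1 / (d : ℝ)) = (3 * K * t)⁻¹ := by
      rw [ht, ← inv_div m, Real.inv_rpow (by positivity), one_div, mul_inv (3 * K)]
    rw [e]
    exact inv_anti₀ (by positivity) hM

theorem second_moment_le {K m δ : ℝ} (hK : 1 ≤ K) (hm : 1 < m)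
    (h : Real.log m ≤ δ ^ 2 * m ^ (1 / 2 : ℝ)) {d M n : ℕ} (hM : 2 ≤ M)
    (hMd : K * m / Real.log m ≤ (M : ℝ) ^ d) (hn : (n : ℝ) ≤ K * m) :
    (1 + 1 / 2 * ((M : ℝ)⁻¹ / 2) ^ d) ^ n * ((M : ℝ)⁻¹) ^ d ≤ δ ^ 2 := by
  have hlog := Real.log_pos hm
  have hm0 : 0 < m := by linarith
  have hT : ((M : ℝ)⁻¹) ^ d ≤ Real.log m / (K * m) := by
    rw [inv_pow, ← inv_div (K * m)]
    exact inv_anti₀ (by positivity) hMd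
  have hT0 : 0 ≤ ((M : ℝ)⁻¹) ^ d := by positivity
  -- The gain `2 ^ (-d)` is dropped; the factor `1 / 2` in `ρ` already yields the exponent `1 / 2`
  -- of `m`.
  have hhalf : ((M : ℝ)⁻¹ / 2) ^ d ≤ ((M : ℝ)⁻¹) ^ d :=
    pow_le_pow_left₀ (by positivity) (half_le_self (by positivity)) d
  have hpow : (1 + 1 / 2 * ((M : ℝ)⁻¹ / 2) ^ d) ^ n ≤ m ^ (1 / 2 : ℝ) := by
    calc _ ≤ Real.exp (1 / 2 * ((M : ℝ)⁻¹ / 2) ^ d) ^ n := by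
          refine pow_le_pow_left₀ (by positivity) ?_ n
          rw [add_comm]; exact Real.add_one_le_exp _
      _ = Real.exp (n * (1 / 2 * ((M : ℝ)⁻¹ / 2) ^ d)) := by rw [← Real.exp_nat_mul]
      _ ≤ Real.exp (Real.log m * (1 / 2)) := by
          refine Real.exp_le_exp.2 ?_
          calc _ ≤ (K * m) * (1 / 2 * (Real.log m / (K * m))) := by
                gcongr; exact hhalf.trans hT
            _ = _ := by field_simp
      _ = _ := by rw [Real.rpow_def_of_pos hm0]
  have hsq : m ^ (1 / 2 : ℝ) * m ^ (1 / 2 : ℝ) = m := by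
    rw [← Real.rpow_add hm0]; norm_num
  calc _ ≤ m ^ (1 / 2 : ℝ) * (Real.log m / (K * m)) := by gcongr
    _ ≤ m ^ (1 / 2 : ℝ) * (δ ^ 2 * m ^ (1 / 2 : ℝ) / (1 * m)) := by gcongr
    _ = δ ^ 2 * (m ^ (1 / 2 : ℝ) * m ^ (1 / 2 : ℝ)) / m := by ring
    _ = δ ^ 2 := by rw [hsq]; field_simp

/-- Reduces the exchanged labels to the case where the second sample is perturbed. -/
theorem expectation_swap {d n₁ n₂ : ℕ} (P Q : Measure (Fin d → ℝ)) [SigmaFinite P]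
    [SigmaFinite Q] (φ : Data d n₁ n₂ → ℝ) :
    expectation P Q φ = expectation Q P fun z : Data d n₂ n₁ => φ z.swap :=
  (integral_prod_swap φ).symm

end TwoSample

/-! ### The sample size threshold and the conclusion. -/

theorem exists_nat_log_le {ε : ℝ} (hε : 0 < ε) :
    ∃ N : ℕ, 2 ≤ N ∧ ∀ m : ℕ, N ≤ m → Real.log m ≤ ε * (m : ℝ) ^ (1 / 2 : ℝ) := by
  have h := ((isLittleO_log_rpow_atTop (r := 1 / 2) (by norm_num)).bound hε)
  obtain ⟨N, hN⟩ := Filter.eventually_atTop.1 (tendsto_natCast_atTop_atTop.eventually h)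
  refine ⟨max N 2, le_max_right _ _, fun m hm => ?_⟩
  have := hN m ((le_max_left _ _).trans hm)
  rw [Real.norm_of_nonneg (Real.rpow_nonneg (Nat.cast_nonneg m) _)] at this
  exact (le_abs_self _).trans this

theorem corollary2 (K : ℝ) (hK : 1 ≤ K) :
    ∃ c : ℝ, 0 < c ∧ ∀ α β : ℝ, 0 < β → β < 1 - α → ∃ N : ℕ,
      ∀ (d : ℕ) (B : ℝ), 1 ≤ d → 2 ≤ B → ∀ n₁ n₂ : ℕ, N ≤ min n₁ n₂ →
        ∀ φ : TwoSample.Data d n₁ n₂ → ℝ, TwoSample.IsTest φ → TwoSample.HasLevel B α φ →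
          ∃ η : ℝ, 0 < η ∧ η < 1 ∧
            c * (Real.log (min n₁ n₂ : ℕ) / (min n₁ n₂ : ℕ)) ^ (1 / (d : ℝ)) ≤ η ∧
            ((n₂ : ℝ) ≤ K * n₁ → ∃ PQ ∈ TwoSample.localized d η,
              TwoSample.expectation PQ.1 PQ.2 φ ≤ 1 - β) ∧
            ((n₁ : ℝ) ≤ K * n₂ → ∃ PQ ∈ TwoSample.localized d η,
              TwoSample.expectation PQ.2 PQ.1 φ ≤ 1 - β) := by
  refine ⟨1 / (3 * K), by positivity, fun α β _ hβ => ?_⟩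
  -- The allowed excess of power over level: `α + δ = 1 - β`.
  obtain ⟨δ, hδ⟩ : ∃ δ, δ = 1 - α - β := ⟨_, rfl⟩
  have hδ0 : 0 < δ := by linarith
  obtain ⟨N, hN2, hN⟩ := exists_nat_log_le (pow_pos hδ0 2)
  refine ⟨N, fun d B hd hB n₁ n₂ hm φ hφ hlevel => ?_⟩
  have hm1 : (1 : ℝ) < (min n₁ n₂ : ℕ) := by exact_mod_cast hN2.trans hm
  have hlog := hN _ hm
  obtain ⟨M, hM2, hMd, hM⟩ := TwoSample.exists_scale hK hm1 hd
  have hMR : (2 : ℝ) ≤ M := by exact_mod_cast hM2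
  have hMη : (M : ℝ) * (M : ℝ)⁻¹ = 1 := mul_inv_cancel₀ (by positivity)
  have hφ0 (z) : 0 ≤ φ z := by rcases hφ.2 z with h | h <;> simp [h]
  have hφ1 (z) : φ z ≤ 1 := by rcases hφ.2 z with h | h <;> simp [h]
  have hnull := hlevel _ (TwoSample.uniform_mem_regular (by omega) (by linarith))
  -- Here `n` is the size of the perturbed sample, the only one entering the second moment.
  have hmK {n n' : ℕ} (h : (n : ℝ) ≤ K * n') : (n : ℝ) ≤ K * (min n' n : ℕ) := by
    rcases min_choice n' n with e | e <;> rw [e]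
    · exact h
    · exact le_mul_of_one_le_left (Nat.cast_nonneg n) hK
  refine ⟨(M : ℝ)⁻¹, by positivity, inv_lt_one_of_one_lt₀ (by linarith), hM, fun h => ?_,
    fun h => ?_⟩
  · obtain ⟨j, hj, hle⟩ := TwoSample.exists_integral_perturbed_le hMη hδ0
      (TwoSample.second_moment_le hK hm1 hlog hM2 hMd (hmK h))
      (Measure.pi fun _ : Fin n₁ => TwoSample.uniform d) hφ.1 hφ0 hφ1
    refine ⟨_, ⟨M, hMη, j, hj, rfl⟩, ?_⟩
    unfold TwoSample.expectation at hnull ⊢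
    linarith
  · have hn : (n₁ : ℝ) ≤ K * (min n₁ n₂ : ℕ) := min_comm n₁ n₂ ▸ hmK h
    obtain ⟨j, hj, hle⟩ := TwoSample.exists_integral_perturbed_le hMη hδ0
      (TwoSample.second_moment_le hK hm1 hlog hM2 hMd hn)
      (Measure.pi fun _ : Fin n₂ => TwoSample.uniform d) (hφ.1.comp measurable_swap)
      (fun z => hφ0 z.swap) (fun z => hφ1 z.swap)
    -- Supplies the σ-finiteness that `expectation_swap` needs.
    have : IsFiniteMeasure (TwoSample.perturbed (M : ℝ)⁻¹ j) :=
      isFiniteMeasure_withDensity_ofReal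
        ((integrable_const _).add (TwoSample.integrable_bump.const_mul _)).2
    refine ⟨_, ⟨M, hMη, j, hj, rfl⟩, ?_⟩
    rw [TwoSample.expectation_swap] at hnull ⊢
    unfold TwoSample.expectation at hnull ⊢
    simp only [Function.comp_apply] at hle
    linarith
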